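/- Let $[m]=\{1,\dots,m\}$. A family $\mathcal G\subset 2^{[n]}$ is $3$-wise $t$-intersecting if $|A\cap B\cap C|\ge t$ for all (not necessarily distinct) $A,B,C\in\mathcal G$, and it is $(3,t)$-maximal if moreover $\mathcal G\cup\{F\}$ is not $3$-wise $t$-intersecting for any $F\in 2^{[n]}\setminus\mathcal G$. For $0<p<1$ let $\mu_p(\mathcal G)=\sum_{G\in\mathcal G}p^{|G|}(1-p)^{n-|G|}$. For $i\ge0$ with $t+3i\le n$ let $\mathcal F_i^t=\{F\subset[n]:|F\cap[t+3i]|\ge t+2i\}$. Two families in $2^{[n]}$ are isomorphic if a permutation of $[n]$ carries one to the other. For $1\le i<j\le n$ the shift $\sigma_{i,j}(\mathcal G)$ is obtained from $\mathcal G$ by replacing each $G\in\mathcal G$ with $G\cap\{i,j\}=\{j\}$ and $G':=(G\setminus\{j\})\cup\{i\}\notin\mathcal G$ by $G'$ and keeping all other members; $\mathcal G$ is shifted if $\sigma_{i,j}(\mathcal G)=\mathcal G$ for all $i<j$. A shifted family $\mathcal H$ is obtained from $\mathcal G$ by shifting if it results from $\mathcal G$ by finitely many such shifts. Let $p_0(t)=\frac{2}{\sqrt{4t+9}-1}$.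 **Proposition.** There is a function $t_0:\mathbb R\to\mathbb N$ such that the following holds for all integers $t\ge 241$ and $n\ge0$ and all real $p$ with $0<p\le p_0(t)$. If $\mathcal G\subset 2^{[n]}$ is a $3$-wise $t$-intersecting family, then at least one of the following holds. (i) $\mu_p(\mathcal G)<\frac12p^t$. (ii) $\mathcal G\subset\mathcal F$ for some $\mathcal F$ isomorphic to $\mathcal F_0^t$ (with $t\le n$) or to $\mathcal F_1^t$ (with $t+3\le n$). (iii) $t+6\le n$ and there is a $(3,t)$-maximal family $\tilde{\mathcal G}\subset 2^{[n]}$ with $\mathcal G\subset\tilde{\mathcal G}$ and a shifted family $\mathcal H$ obtained from $\tilde{\mathcal G}$ by shifting such that $\mathcal H\subset\mathcal F_2^t$; moreover, for every $\delta>0$, if $t>t_0(\delta)$ then $\mu_p(\mathcal G)<(\frac12+\delta)p^t$. -/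

import Mathlib

namespace ThreeWise

/-- `𝒢 ⊆ 2^[n]` is `3`-wise `t`-intersecting. The ground set `[n]` is modelled by `Fin n`,
its element `k` being the member of `Fin n` with value `k - 1`. -/
def IsThreeWise {n : ℕ} (t : ℕ) (𝒢 : Finset (Finset (Fin n))) : Prop :=
  ∀ A ∈ 𝒢, ∀ B ∈ 𝒢, ∀ C ∈ 𝒢, t ≤ (A ∩ B ∩ C).card

/-- The `p`-biased measure of a family of subsets of `[n]`. -/
noncomputable def mu {n : ℕ} (p : ℝ) (𝒢 : Finset (Finset (Fin n))) : ℝ :=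
  ∑ G ∈ 𝒢, p ^ G.card * (1 - p) ^ (n - G.card)

/-- The initial segment `[m] ∩ [n]` of the ground set `[n]`. -/
def seg (n m : ℕ) : Finset (Fin n) :=
  Finset.univ.filter fun x => x.val < m

/-- The family `𝓕_i^t = {F ⊆ [n] : |F ∩ [t + 3i]| ≥ t + 2i}` (meant for `t + 3i ≤ n`). -/
def fam (n t i : ℕ) : Finset (Finset (Fin n)) :=
  Finset.univ.filter fun F => t + 2 * i ≤ (F ∩ seg n (t + 3 * i)).card

/-- Two families are isomorphic if a permutation of the ground set carries one to the other. -/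
def Iso {n : ℕ} (𝒢 ℋ : Finset (Finset (Fin n))) : Prop :=
  ∃ τ : Equiv.Perm (Fin n), ℋ = 𝒢.image fun G => G.image τ

/-- The threshold `p₀(t) = 2 / (√(4t+9) - 1)`. -/
noncomputable def p₀ (t : ℕ) : ℝ := 2 / (Real.sqrt (4 * t + 9) - 1)

/-- The map `s_{i,j}` on sets, relative to the family `𝒢`. -/
def shiftSet {n : ℕ} (𝒢 : Finset (Finset (Fin n))) (i j : Fin n) (G : Finset (Fin n)) :
    Finset (Fin n) :=
  if G ∩ {i, j} = {j} ∧ (G \ {j}) ∪ {i} ∉ 𝒢 then (G \ {j}) ∪ {i} else G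

/-- The shifting operation `σ_{i,j}`. -/
def shift {n : ℕ} (i j : Fin n) (𝒢 : Finset (Finset (Fin n))) : Finset (Finset (Fin n)) :=
  𝒢.image (shiftSet 𝒢 i j)

/-- A family is shifted if it is invariant under all `σ_{i,j}` with `i < j`. -/
def IsShifted {n : ℕ} (𝒢 : Finset (Finset (Fin n))) : Prop :=
  ∀ i j : Fin n, i < j → shift i j 𝒢 = 𝒢

/-- `ℋ` is a shifted family obtained from `𝒢` by finitely many shifting operations
`σ_{i,j}` with `i < j`. -/
def ObtainedByShifting {n : ℕ} (𝒢 ℋ : Finset (Finset (Fin n))) : Prop :=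
  Relation.ReflTransGen (fun 𝒜 ℬ => ∃ i j : Fin n, i < j ∧ ℬ = shift i j 𝒜) 𝒢 ℋ ∧ IsShifted ℋ

/-- `𝒢` is `(3,t)`-maximal: it is `3`-wise `t`-intersecting and no further set can be added. -/
def IsMaximal {n : ℕ} (t : ℕ) (𝒢 : Finset (Finset (Fin n))) : Prop :=
  IsThreeWise t 𝒢 ∧ ∀ F : Finset (Fin n), F ∉ 𝒢 → ¬ IsThreeWise t (insert F 𝒢)

end ThreeWise

/-!
Extend `𝒢` to a maximal family, which is an up-set, and shift it to a shifted family `ℋ`; neither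
operation decreases the measure. Read a member of `ℋ` as a walk that goes up at its elements and
right elsewhere. Since `ℋ` is shifted and `3`-wise `t`-intersecting, every such walk meets the line
`y = 2x + t`, and `ℋ` splits according to the first meeting point `(i, t + 2i)`. The union bounds
for the parts halve from `i = 4` on. If `ℋ` is not contained in `𝓕_i^t` with `i ≤ 2`, it contains a
single large set `D` forcing the following: two sets of `i` positions missed by members of part `i`
are either intersecting or have cross-intersecting links, one of which then has small measure. The
Erdős–Ko–Rado theorem bounds the number of positions with large links, so these parts are small
and `μ_p(ℋ) < p^t / 2`.

If `ℋ ⊆ 𝓕_0^t` or `ℋ ⊆ 𝓕_1^t`, undo the shifts one at a time. A family whose shift by `σ_{i,j}` lies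
in a copy of `𝓕_r^t` lies in such a copy itself, unless some member avoids `i` and another avoids
`j` in a way that makes the links cross-intersecting again, and then its measure is small.
-/

namespace ThreeWise

open Finset

section Biased

variable {α : Type*}

open Classical in
/-- The `p`-biased probability that a random subset of `X` lies in `𝒜`. The members of `𝒜` that
are not contained in `X` do not count. -/
noncomputable def biasedProb (p : ℝ) (X : Finset α) (𝒜 : Set (Finset α)) : ℝ :=
  ∑ A ∈ X.powerset with A ∈ 𝒜, p ^ #A * (1 - p) ^ (#X - #A)

variable {p : ℝ} {X : Finset α} {𝒜 ℬ : Set (Finset α)}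

theorem biasedProb_mono (hp₀ : 0 ≤ p) (hp₁ : p ≤ 1) (h : ∀ A ⊆ X, A ∈ 𝒜 → A ∈ ℬ) :
    biasedProb p X 𝒜 ≤ biasedProb p X ℬ := by
  classical
  have : 0 ≤ 1 - p := sub_nonneg.2 hp₁
  refine sum_le_sum_of_subset_of_nonneg (fun A hA => ?_) fun A _ _ => by positivity
  rw [mem_filter, mem_powerset] at hA ⊢
  exact ⟨hA.1, h A hA.1 hA.2⟩

theorem biasedProb_univ : biasedProb p X Set.univ = 1 := by
  simp [biasedProb, sum_pow_mul_eq_add_pow]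

theorem biasedProb_le_one (hp₀ : 0 ≤ p) (hp₁ : p ≤ 1) : biasedProb p X 𝒜 ≤ 1 :=
  (biasedProb_mono hp₀ hp₁ fun _ _ _ => Set.mem_univ _).trans_eq biasedProb_univ

theorem biasedProb_insert [DecidableEq α] {x : α} (hx : x ∉ X) :
    biasedProb p (insert x X) 𝒜 =
      (1 - p) * biasedProb p X 𝒜 + p * biasedProb p X (insert x ⁻¹' 𝒜) := by
  classical
  simp only [biasedProb, sum_filter, sum_powerset_insert hx, mul_sum, card_insert_of_notMem hx,
    mul_ite, mul_zero]
  congr 1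
  · refine sum_congr rfl fun A hA => ?_
    rw [Nat.sub_add_comm (card_le_card (mem_powerset.1 hA)), pow_succ]
    exact if_congr Iff.rfl (by ring) rfl
  · refine sum_congr rfl fun A hA => ?_
    rw [card_insert_of_notMem (notMem_mono (mem_powerset.1 hA) hx), Nat.add_sub_add_right, pow_succ]
    exact if_congr Iff.rfl (by ring) rfl

theorem pow_mul_add_le_add_pow {q u v : ℝ} (hq₀ : 0 ≤ q) (hq₁ : q ≤ 1) (hv : 0 ≤ v)
    (hvu : v ≤ u) (s : ℕ) :
    q ^ s * u ^ s + (1 - q ^ s) * v ^ s ≤ (q * u + (1 - q) * v) ^ s := by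
  have : 0 ≤ 1 - q := sub_nonneg.2 hq₁
  have hu : 0 ≤ u := hv.trans hvu
  induction s with
  | zero => simp
  | succ s ih =>
    have hqs : 0 ≤ 1 - q ^ s := sub_nonneg.2 (pow_le_one₀ hq₀ hq₁)
    have hu' : 0 ≤ u ^ s - v ^ s := sub_nonneg.2 (by gcongr)
    have : 0 ≤ u - v := sub_nonneg.2 hvu
    calc q ^ (s + 1) * u ^ (s + 1) + (1 - q ^ (s + 1)) * v ^ (s + 1)
        ≤ q ^ (s + 1) * u ^ (s + 1) + (1 - q ^ (s + 1)) * v ^ (s + 1) +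
            (q ^ s * (1 - q) * v * (u ^ s - v ^ s) + q * (1 - q ^ s) * v ^ s * (u - v)) :=
          le_add_of_nonneg_right (by positivity)
      _ = (q ^ s * u ^ s + (1 - q ^ s) * v ^ s) * (q * u + (1 - q) * v) := by ring
      _ ≤ (q * u + (1 - q) * v) ^ (s + 1) := by rw [pow_succ (_ + _)]; gcongr

/-- The induction removes a point `x` of `X`: a member of one family that avoids `x` crosses a
member of the other only outside `x`, so the links of `x` cross in both mixed ways. -/
theorem biasedProb_le_one_sub_pow_of_cross {s : ℕ} (hp₀ : 0 ≤ p) (hp₁ : p ≤ 1)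
    (hs : p ≤ (1 - p) ^ s) (h𝒜 : IsUpperSet 𝒜)
    (hcross : ∀ A ∈ 𝒜, ∀ B ∈ ℬ, A ⊆ X → B ⊆ X → ¬ Disjoint A B) :
    biasedProb p X ℬ ≤ (1 - biasedProb p X 𝒜) ^ s := by
  classical
  induction X using Finset.induction_on generalizing 𝒜 ℬ with
  | empty =>
    have hnot_both (hA : ∅ ∈ 𝒜) (hB : ∅ ∈ ℬ) : False :=
      hcross ∅ hA ∅ hB subset_rfl subset_rfl (disjoint_empty_left ∅)
    by_cases hA : ∅ ∈ 𝒜 <;> by_cases hB : ∅ ∈ ℬ <;>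
      simp_all [biasedProb, filter_singleton]
  | insert x X hx ih =>
    have hx' {A} (hA : A ⊆ X) : x ∉ A := notMem_mono hA hx
    set a₀ := biasedProb p X 𝒜
    set a₁ := biasedProb p X (insert x ⁻¹' 𝒜)
    have h𝒜x : IsUpperSet (insert x ⁻¹' 𝒜) := fun A B hAB => h𝒜 (insert_subset_insert x hAB)
    have hb₀ : biasedProb p X ℬ ≤ (1 - a₁) ^ s := ih h𝒜x fun A hA B hB hAX hBX => by
      have := hcross _ hA B hB (insert_subset_insert x hAX) (hBX.trans (subset_insert x X))
      rwa [disjoint_insert_left, and_iff_right (hx' hBX)] at this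
    have hb₁ : biasedProb p X (insert x ⁻¹' ℬ) ≤ (1 - a₀) ^ s := ih h𝒜 fun A hA B hB hAX hBX => by
      have := hcross A hA _ hB (hAX.trans (subset_insert x X)) (insert_subset_insert x hBX)
      rwa [disjoint_insert_right, and_iff_right (hx' hAX)] at this
    have ha : a₀ ≤ a₁ := biasedProb_mono hp₀ hp₁ fun A _ => h𝒜 (subset_insert x A)
    have ha₁' : 0 ≤ 1 - a₁ := sub_nonneg.2 (biasedProb_le_one hp₀ hp₁)
    have : 0 ≤ 1 - p := sub_nonneg.2 hp₁
    have hpow : (1 - a₁) ^ s ≤ (1 - a₀) ^ s := by gcongr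
    calc biasedProb p (insert x X) ℬ
        ≤ (1 - p) * (1 - a₁) ^ s + p * (1 - a₀) ^ s := by rw [biasedProb_insert hx]; gcongr
      _ ≤ (1 - p) ^ s * (1 - a₀) ^ s + (1 - (1 - p) ^ s) * (1 - a₁) ^ s := by
        linarith [mul_le_mul_of_nonneg_left hpow (sub_nonneg.2 hs)]
      _ ≤ ((1 - p) * (1 - a₀) + (1 - (1 - p)) * (1 - a₁)) ^ s :=
        pow_mul_add_le_add_pow (sub_nonneg.2 hp₁) (by linarith) ha₁' (by linarith) s
      _ = (1 - biasedProb p (insert x X) 𝒜) ^ s := by rw [biasedProb_insert hx]; ring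

theorem biasedProb_le_or_le_of_cross (hp₀ : 0 ≤ p) (hp : p ≤ 1 / 15)
    (h𝒜 : IsUpperSet 𝒜) (hcross : ∀ A ∈ 𝒜, ∀ B ∈ ℬ, A ⊆ X → B ⊆ X → ¬ Disjoint A B) :
    biasedProb p X 𝒜 ≤ 3 / 40 ∨ biasedProb p X ℬ ≤ 3 / 40 := by
  have hp₁ : p ≤ 1 := by linarith
  refine or_iff_not_imp_left.2 fun h𝒜_gt => ?_
  have hs : p ≤ (1 - p) ^ 34 := calc
    p ≤ 1 / 15 := hp
    _ ≤ (14 / 15) ^ 34 := by norm_num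
    _ ≤ (1 - p) ^ 34 := by gcongr; linarith
  calc biasedProb p X ℬ ≤ (1 - biasedProb p X 𝒜) ^ 34 :=
        biasedProb_le_one_sub_pow_of_cross hp₀ hp₁ hs h𝒜 hcross
    _ ≤ (37 / 40) ^ 34 := by
      gcongr
      · exact sub_nonneg.2 (biasedProb_le_one hp₀ hp₁)
      · linarith
    _ ≤ 3 / 40 := by norm_num

end Biased

section Link

variable {n t k m : ℕ} {p : ℝ} {𝒢 ℋ 𝒜 𝓜 : Finset (Finset (Fin n))} {U D M M' : Finset (Fin n)}

theorem mu_mono (hp₀ : 0 ≤ p) (hp₁ : p ≤ 1) (h : 𝒢 ⊆ ℋ) : mu p 𝒢 ≤ mu p ℋ := by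
  have : 0 ≤ 1 - p := sub_nonneg.2 hp₁
  exact sum_le_sum_of_subset_of_nonneg h fun A _ _ => by positivity

theorem mu_union_le (hp₀ : 0 ≤ p) (hp₁ : p ≤ 1) : mu p (𝒢 ∪ ℋ) ≤ mu p 𝒢 + mu p ℋ := by
  have : 0 ≤ 1 - p := sub_nonneg.2 hp₁
  have hinter : 0 ≤ mu p (𝒢 ∩ ℋ) := sum_nonneg fun A _ => by positivity
  have hsum : mu p (𝒢 ∪ ℋ) + mu p (𝒢 ∩ ℋ) = mu p 𝒢 + mu p ℋ := sum_union_inter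
  linarith

theorem mu_biUnion_le {ι : Type*} (hp₀ : 0 ≤ p) (hp₁ : p ≤ 1) (s : Finset ι)
    (f : ι → Finset (Finset (Fin n))) : mu p (s.biUnion f) ≤ ∑ i ∈ s, mu p (f i) := by
  classical
  induction s using Finset.induction_on with
  | empty => simp [mu]
  | insert i s hi ih =>
    rw [biUnion_insert, sum_insert hi]
    exact (mu_union_le hp₀ hp₁).trans (by gcongr)

/-- The link of `R` in `𝒢`. Its members are allowed to meet `R`, since only their traces on the
complement of `R` are measured. -/
def link (𝒢 : Finset (Finset (Fin n))) (R : Finset (Fin n)) : Set (Finset (Fin n)) :=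
  {Y | R ∪ Y ∈ 𝒢}

theorem isUpperSet_link (h𝒢 : IsUpperSet (𝒢 : Set (Finset (Fin n)))) (R : Finset (Fin n)) :
    IsUpperSet (link 𝒢 R) :=
  fun _ _ hAB hA => h𝒢 (union_subset_union_right hAB) hA

theorem mu_filter_sdiff_eq (hM : M ⊆ U) :
    mu p {F ∈ 𝒢 | U \ F = M} =
      p ^ #(U \ M) * (1 - p) ^ #M * biasedProb p Uᶜ (link 𝒢 (U \ M)) := by
  classical
  rw [mu, biasedProb, mul_sum]
  refine sum_nbij' (· \ U) (U \ M ∪ ·) ?_ ?_ ?_ ?_ ?_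
  · intro F hF
    rw [mem_filter] at hF
    obtain ⟨hF, rfl⟩ := hF
    rw [mem_filter, mem_powerset]
    refine ⟨by grind [mem_compl], ?_⟩
    rwa [link, Set.mem_ofPred_eq, show U \ (U \ F) ∪ F \ U = F by grind]
  · intro A hA
    rw [mem_filter, mem_powerset, subset_compl_iff_disjoint_right] at hA
    rw [mem_filter]
    exact ⟨hA.2, by grind [disjoint_left]⟩
  · grind
  · grind [mem_compl]
  · intro F hF
    rw [mem_filter] at hF
    obtain ⟨-, rfl⟩ := hF
    have hF : #(U ∩ F) + #(F \ U) = #F := by rw [inter_comm, card_inter_add_card_sdiff]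
    have hU : #(U \ F) + (#Uᶜ - #(F \ U)) = n - #F := by
      have := card_sdiff_add_card U F
      have := card_sdiff_add_card F U
      have := card_le_univ (U ∪ F)
      rw [Fintype.card_fin] at this
      rw [card_compl, Fintype.card_fin]
      grind [union_comm]
    rw [sdiff_sdiff_right_self, inf_eq_inter, ← hU, ← hF, pow_add, pow_add]
    ring

/-- Conditionally on missing exactly `M` within `U`, a random set lies in `𝒢` with probability more
than `3 / 40` when `M` is heavy. -/
noncomputable def heavy (p : ℝ) (𝒢 : Finset (Finset (Fin n))) (U : Finset (Fin n))
    (𝓜 : Finset (Finset (Fin n))) : Finset (Finset (Fin n)) :=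
  {M ∈ 𝓜 | 3 / 40 < biasedProb p Uᶜ (link 𝒢 (U \ M))}

theorem le_card_of_mem_heavy (hp₀ : 0 ≤ p) (hp : p ≤ 1 / 15) (h𝒢 : IsThreeWise t 𝒢)
    (hup : IsUpperSet (𝒢 : Set (Finset (Fin n)))) (hD : D ∈ 𝒢) (hM : M ∈ heavy p 𝒢 U 𝓜)
    (hM' : M' ∈ heavy p 𝒢 U 𝓜) : t ≤ #((U ∩ D) \ (M ∪ M')) := by
  by_contra! hlt
  rw [heavy, mem_filter] at hM hM'
  refine (biasedProb_le_or_le_of_cross hp₀ hp (isUpperSet_link hup (U \ M))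
    fun A hA B hB hAU hBU hAB => ?_).elim hM.2.not_ge hM'.2.not_ge
  refine hlt.not_ge ((h𝒢 _ hA _ hB D hD).trans (card_le_card fun x hx => ?_))
  grind [disjoint_left, mem_compl]

theorem sum_le_card_filter_add {ι : Type*} (s : Finset ι) (f : ι → ℝ) {c : ℝ} (hc : 0 ≤ c)
    (hf : ∀ a ∈ s, f a ≤ 1) : ∑ a ∈ s, f a ≤ #{a ∈ s | c < f a} + #s * c := by
  have hle : ∀ a ∈ s, f a ≤ (if c < f a then 1 else 0) + c := fun a ha => by
    have := hf a ha
    split_ifs <;> linarith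
  simpa [sum_add_distrib] using sum_le_sum hle

theorem mu_le_sum_biasedProb_link (hp₀ : 0 ≤ p) (hp₁ : p ≤ 1) (h𝒜 : ∀ F ∈ 𝒜, F ∈ 𝒢 ∧ U \ F ∈ 𝓜)
    (h𝓜 : 𝓜 ⊆ U.powersetCard m) (hU : #U = k + m) :
    mu p 𝒜 ≤ p ^ k * (1 - p) ^ m * ∑ M ∈ 𝓜, biasedProb p Uᶜ (link 𝒢 (U \ M)) := calc
  mu p 𝒜 ≤ mu p (𝓜.biUnion fun M => {F ∈ 𝒢 | U \ F = M}) :=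
    mu_mono hp₀ hp₁ fun F hF => by simpa using (h𝒜 F hF).symm
  _ ≤ ∑ M ∈ 𝓜, mu p {F ∈ 𝒢 | U \ F = M} := mu_biUnion_le hp₀ hp₁ 𝓜 _
  _ = p ^ k * (1 - p) ^ m * ∑ M ∈ 𝓜, biasedProb p Uᶜ (link 𝒢 (U \ M)) := by
    rw [mul_sum]
    refine sum_congr rfl fun M hM => ?_
    obtain ⟨hMU, hMm⟩ := mem_powersetCard.1 (h𝓜 hM)
    rw [mu_filter_sdiff_eq hMU, card_sdiff_of_subset hMU, hU, hMm, Nat.add_sub_cancel]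

theorem mu_le_mul_card_heavy_add (hp₀ : 0 ≤ p) (hp₁ : p ≤ 1)
    (h𝒜 : ∀ F ∈ 𝒜, F ∈ 𝒢 ∧ U \ F ∈ 𝓜) (h𝓜 : 𝓜 ⊆ U.powersetCard m) (hU : #U = k + m) :
    mu p 𝒜 ≤ p ^ k * (1 - p) ^ m * (#(heavy p 𝒢 U 𝓜) + #𝓜 * (3 / 40)) := by
  have : 0 ≤ 1 - p := sub_nonneg.2 hp₁
  refine (mu_le_sum_biasedProb_link hp₀ hp₁ h𝒜 h𝓜 hU).trans ?_
  gcongr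
  exact sum_le_card_filter_add 𝓜 _ (by norm_num) fun M _ => biasedProb_le_one hp₀ hp₁

theorem mu_le_mul_card (hp₀ : 0 ≤ p) (hp₁ : p ≤ 1) (h𝒜 : ∀ F ∈ 𝒜, U \ F ∈ 𝓜)
    (h𝓜 : 𝓜 ⊆ U.powersetCard m) (hU : #U = k + m) :
    mu p 𝒜 ≤ p ^ k * (1 - p) ^ m * #𝓜 := by
  have : 0 ≤ 1 - p := sub_nonneg.2 hp₁
  refine (mu_le_sum_biasedProb_link hp₀ hp₁ (fun F hF => ⟨hF, h𝒜 F hF⟩) h𝓜 hU).trans ?_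
  gcongr
  simpa using sum_le_card_nsmul 𝓜 _ 1 fun M _ => biasedProb_le_one hp₀ hp₁

end Link

section Shift

variable {n t : ℕ} {p : ℝ} {i j : Fin n} {𝒢 ℋ : Finset (Finset (Fin n))} {A : Finset (Fin n)}

theorem shiftSet_eq_ite (𝒢 : Finset (Finset (Fin n))) (i j : Fin n) (A : Finset (Fin n)) :
    shiftSet 𝒢 i j A =
      if i ∉ A ∧ j ∈ A ∧ insert i (A.erase j) ∉ 𝒢 then insert i (A.erase j) else A := by
  have hset : A \ {j} ∪ {i} = insert i (A.erase j) := by grind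
  have hinter : A ∩ {i, j} = {j} ↔ j ∈ A ∧ (i ∉ A ∨ i = j) :=
    ⟨fun h => by grind [Finset.ext_iff.1 h i, Finset.ext_iff.1 h j], by grind⟩
  rw [shiftSet, hset]
  grind

theorem insert_erase_insert_erase (hi : i ∉ A) (hj : j ∈ A) :
    insert j ((insert i (A.erase j)).erase i) = A := by
  rw [erase_insert fun h => hi (mem_of_mem_erase h), insert_erase hj]

theorem mem_shift_iff : A ∈ shift i j 𝒢 ↔
    A ∈ 𝒢 ∧ (i ∉ A → j ∈ A → insert i (A.erase j) ∈ 𝒢) ∨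
      A ∉ 𝒢 ∧ i ∈ A ∧ j ∉ A ∧ insert j (A.erase i) ∈ 𝒢 := by
  simp only [shift, mem_image, shiftSet_eq_ite]
  constructor
  · grind [insert_erase_insert_erase]
  · rintro (⟨hA, h⟩ | ⟨hA, hi, hj, h⟩)
    · exact ⟨A, hA, by grind⟩
    · exact ⟨_, h, by grind [insert_erase_insert_erase]⟩

theorem injOn_shiftSet (𝒢 : Finset (Finset (Fin n))) (i j : Fin n) :
    Set.InjOn (shiftSet 𝒢 i j) 𝒢 := by
  intro A hA B hB hAB
  rw [mem_coe] at hA hB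
  simp only [shiftSet_eq_ite] at hAB
  grind [insert_erase_insert_erase]

theorem sum_shift {M : Type*} [AddCommMonoid M] (f : Finset (Fin n) → M) :
    ∑ A ∈ shift i j 𝒢, f A = ∑ A ∈ 𝒢, f (shiftSet 𝒢 i j A) :=
  sum_image (injOn_shiftSet 𝒢 i j)

theorem card_shiftSet : #(shiftSet 𝒢 i j A) = #A := by
  rw [shiftSet_eq_ite]
  split_ifs with h
  · rw [card_insert_of_notMem (by grind), card_erase_add_one h.2.1]
  · rfl

theorem mu_shift : mu p (shift i j 𝒢) = mu p 𝒢 := by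
  simp only [mu, sum_shift, card_shiftSet]

theorem sum_val_shiftSet_lt (hij : i < j) (hA : shiftSet 𝒢 i j A ≠ A) :
    ∑ x ∈ shiftSet 𝒢 i j A, x.val < ∑ x ∈ A, x.val := by
  rw [shiftSet_eq_ite] at hA ⊢
  split_ifs at hA ⊢ with h
  · rw [sum_insert (by grind), ← sum_erase_add A _ h.2.1, add_comm]
    exact Nat.add_lt_add_left hij _
  · exact absurd rfl hA

theorem exists_obtainedByShifting (𝒢 : Finset (Finset (Fin n))) :
    ∃ ℋ, ObtainedByShifting 𝒢 ℋ := by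
  induction h : ∑ A ∈ 𝒢, ∑ x ∈ A, x.val using Nat.strong_induction_on generalizing 𝒢 with
  | _ N ih =>
    by_cases hs : IsShifted 𝒢
    · exact ⟨𝒢, .refl, hs⟩
    obtain ⟨i, j, hij, hne⟩ : ∃ i j : Fin n, i < j ∧ shift i j 𝒢 ≠ 𝒢 := by
      simpa [IsShifted] using hs
    obtain ⟨A, hA, hAne⟩ : ∃ A ∈ 𝒢, shiftSet 𝒢 i j A ≠ A := by
      by_contra! hfix
      exact hne ((image_congr hfix).trans image_id')
    have hlt : ∑ A ∈ shift i j 𝒢, ∑ x ∈ A, x.val < N := by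
      rw [sum_shift, ← h]
      refine sum_lt_sum (fun B _ => ?_) ⟨A, hA, sum_val_shiftSet_lt hij hAne⟩
      by_cases hB : shiftSet 𝒢 i j B = B
      · rw [hB]
      · exact (sum_val_shiftSet_lt hij hB).le
    obtain ⟨ℋ, hℋ, hℋs⟩ := ih _ hlt _ rfl
    exact ⟨ℋ, .head ⟨i, j, hij, rfl⟩ hℋ, hℋs⟩

theorem isUpperSet_shift (h𝒢 : IsUpperSet (𝒢 : Set (Finset (Fin n)))) :
    IsUpperSet (shift i j 𝒢 : Set (Finset (Fin n))) := by
  have hup {A B : Finset (Fin n)} (hAB : A ⊆ B) (hA : A ∈ 𝒢) : B ∈ 𝒢 := h𝒢 hAB hA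
  intro A B (hAB : A ⊆ B) hA
  rw [mem_coe, mem_shift_iff] at hA ⊢
  rcases hA with ⟨hA, hAij⟩ | ⟨-, hi, -, hA'⟩
  · refine .inl ⟨hup hAB hA, fun hi _ => ?_⟩
    by_cases hjA : j ∈ A
    · exact hup (by grind) (hAij (by grind) hjA)
    · exact hup (by grind) hA
  · by_cases hB : B ∈ 𝒢
    · exact .inl ⟨hB, fun hi' => absurd (hAB hi) hi'⟩
    · have hj' : j ∉ B := fun hj' => hB (hup (by grind) hA')
      exact .inr ⟨hB, hAB hi, hj', hup (by grind) hA'⟩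

theorem exists_mem_of_mem_shift {B : Finset (Fin n)} (hB : B ∈ shift i j 𝒢) :
    ∃ B' ∈ 𝒢, (∀ x ∈ B', x ≠ i → x ≠ j → x ∈ B) ∧ (j ∈ B' → i ∈ B) := by
  rcases mem_shift_iff.1 hB with ⟨hB, hBij⟩ | ⟨-, hi, -, hB'⟩
  · by_cases h : i ∉ B ∧ j ∈ B
    · exact ⟨_, hBij h.1 h.2, by grind⟩
    · exact ⟨B, hB, by grind⟩
  · exact ⟨_, hB', by grind⟩

theorem le_card_inter_of_mem_shift_of_notMem {B C : Finset (Fin n)} (h𝒢 : IsThreeWise t 𝒢)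
    (hA : A ∈ shift i j 𝒢) (hA' : A ∉ 𝒢) (hB : B ∈ shift i j 𝒢) (hC : C ∈ shift i j 𝒢) :
    t ≤ #(A ∩ B ∩ C) := by
  obtain ⟨-, hi, hj, hA₀⟩ := (mem_shift_iff.1 hA).resolve_left fun h => hA' h.1
  obtain ⟨B₀, hB₀, hBB₀, hjB₀⟩ := exists_mem_of_mem_shift hB
  obtain ⟨C₀, hC₀, hCC₀, hjC₀⟩ := exists_mem_of_mem_shift hC
  refine (h𝒢 _ hA₀ B₀ hB₀ C₀ hC₀).trans
    (card_le_card_of_injOn (Equiv.swap i j) (fun x hx => ?_) (Equiv.injective _).injOn)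
  have hxi : x ≠ i := by grind
  by_cases hxj : x = j
  · subst hxj
    rw [Equiv.swap_apply_right]
    grind
  · rw [Equiv.swap_apply_of_ne_of_ne hxi hxj]
    grind

theorem IsThreeWise.shift (h𝒢 : IsThreeWise t 𝒢) : IsThreeWise t (shift i j 𝒢) := by
  intro A hA B hB C hC
  by_cases hA' : A ∈ 𝒢
  · by_cases hB' : B ∈ 𝒢
    · by_cases hC' : C ∈ 𝒢
      · exact h𝒢 A hA' B hB' C hC'
      · rw [inter_comm, ← inter_assoc]
        exact le_card_inter_of_mem_shift_of_notMem h𝒢 hC hC' hA hB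
    · rw [inter_comm A]
      exact le_card_inter_of_mem_shift_of_notMem h𝒢 hB hB' hA hC
  · exact le_card_inter_of_mem_shift_of_notMem h𝒢 hA hA' hB hC

theorem IsThreeWise.exists_isMaximal (h𝒢 : IsThreeWise t 𝒢) :
    ∃ ℋ, 𝒢 ⊆ ℋ ∧ IsMaximal t ℋ := by
  obtain ⟨ℋ, hle, hℋ⟩ := (Set.toFinite {ℋ | IsThreeWise t ℋ}).exists_le_maximal h𝒢
  refine ⟨ℋ, hle, hℋ.prop, fun F hF hins => hF ?_⟩
  exact hℋ.le_of_ge hins (subset_insert F ℋ) (mem_insert_self F ℋ)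

theorem IsMaximal.isUpperSet (h𝒢 : IsMaximal t 𝒢) : IsUpperSet (𝒢 : Set (Finset (Fin n))) := by
  intro A B hAB hA
  by_contra hB
  refine h𝒢.2 B hB fun X hX Y hY Z hZ => ?_
  have hsub {X} (hX : X ∈ insert B 𝒢) : ∃ X' ∈ 𝒢, X' ⊆ X := by
    rcases mem_insert.1 hX with rfl | hX
    exacts [⟨A, hA, hAB⟩, ⟨X, hX, subset_rfl⟩]
  obtain ⟨X', hX', hXX'⟩ := hsub hX
  obtain ⟨Y', hY', hYY'⟩ := hsub hY
  obtain ⟨Z', hZ', hZZ'⟩ := hsub hZ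
  exact (h𝒢.1 X' hX' Y' hY' Z' hZ').trans (by gcongr)

end Shift

section Walk

variable {n t i a b m s : ℕ} {ℋ : Finset (Finset (Fin n))} {A D F : Finset (Fin n)}

theorem mem_seg {x : Fin n} : x ∈ seg n m ↔ x.val < m := by simp [seg]

theorem seg_subset_seg (hab : a ≤ b) : seg n a ⊆ seg n b :=
  fun _ hx => mem_seg.2 ((mem_seg.1 hx).trans_le hab)

theorem card_seg : #(seg n m) = min m n := by
  rw [seg, Fin.card_filter_val_lt, min_comm]

theorem card_seg_sdiff_seg : #(seg n b \ seg n a) = min b n - a := by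
  have hinter : seg n a ∩ seg n b = seg n (min a b) := by grind [mem_seg]
  rw [card_sdiff, hinter, card_seg, card_seg]
  lia

/-- The number of elements of `F` among the first `m` elements of the ground set, which is the
height after `m` steps of the walk that goes up at the elements of `F` and right elsewhere. -/
def prefixCard (F : Finset (Fin n)) (m : ℕ) : ℕ := #(F ∩ seg n m)

theorem card_seg_sdiff_add_prefixCard (F : Finset (Fin n)) (m : ℕ) :
    #(seg n m \ F) + prefixCard F m = min m n := by
  rw [prefixCard, inter_comm, card_sdiff_add_card_inter, card_seg]

theorem prefixCard_le_add (F : Finset (Fin n)) (a b : ℕ) :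
    prefixCard F b ≤ prefixCard F a + (min b n - a) := calc
  #(F ∩ seg n b) ≤ #(F ∩ seg n a ∪ seg n b \ seg n a) := card_le_card (by grind)
  _ ≤ prefixCard F a + (min b n - a) := by
    rw [← card_seg_sdiff_seg]
    exact card_union_le _ _

theorem IsShifted.insert_erase_mem {i j : Fin n} (hℋ : IsShifted ℋ) (hij : i < j) (hF : F ∈ ℋ)
    (hi : i ∉ F) (hj : j ∈ F) : insert i (F.erase j) ∈ ℋ := by
  rw [← hℋ i j hij, mem_shift_iff] at hF
  tauto

theorem exists_lt_of_prefixCard_le (h : ∀ m ≤ n, prefixCard F m ≤ prefixCard D m)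
    (hFD : ¬ F ⊆ D) :
    ∃ i j : Fin n, i < j ∧ i ∈ D \ F ∧ j ∈ F \ D ∧ ∀ x ∈ F, x < j → x ∈ D := by
  have hne : (F \ D).Nonempty := sdiff_nonempty.2 hFD
  set j := (F \ D).min' hne
  have hj : j ∈ F \ D := min'_mem _ hne
  have hmin (x) (hx : x ∈ F) (hxj : x < j) : x ∈ D := by
    by_contra hxD
    exact hxj.not_ge (min'_le _ x (mem_sdiff.2 ⟨hx, hxD⟩))
  suffices ∃ i < j, i ∈ D \ F by
    obtain ⟨i, hij, hi⟩ := this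
    exact ⟨i, j, hij, hi, hj, hmin⟩
  by_contra! hD
  have hlt : prefixCard D (j + 1) < prefixCard F (j + 1) := by
    refine card_lt_card (ssubset_iff_of_subset ?_ |>.2 ⟨j, ?_⟩)
    · intro x hx
      have := hD x
      grind [mem_seg]
    · grind [mem_seg]
  exact hlt.not_ge (h _ j.isLt)

theorem prefixCard_insert_erase_le {i j : Fin n} (hij : i < j) (hi : i ∈ D \ F) (hj : j ∈ F)
    (hFD : ∀ x ∈ F, x < j → x ∈ D) (h : prefixCard F m ≤ prefixCard D m) :
    prefixCard (insert i (F.erase j)) m ≤ prefixCard D m := by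
  by_cases hm : j < m
  · have hset : insert i (F.erase j) ∩ seg n m = insert i ((F ∩ seg n m).erase j) := by
      grind [mem_seg]
    rwa [prefixCard, hset, card_insert_of_notMem (by grind),
      card_erase_add_one (mem_inter.2 ⟨hj, mem_seg.2 hm⟩)]
  · refine card_le_card fun x hx => ?_
    grind [mem_seg]

theorem IsShifted.mem_of_prefixCard_le (hs : IsShifted ℋ)
    (hup : IsUpperSet (ℋ : Set (Finset (Fin n)))) (hF : F ∈ ℋ)
    (h : ∀ m ≤ n, prefixCard F m ≤ prefixCard D m) : D ∈ ℋ := by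
  induction hN : #(D \ F) using Nat.strong_induction_on generalizing F with
  | _ N ih =>
    by_cases hFD : F ⊆ D
    · exact hup hFD hF
    obtain ⟨i, j, hij, hi, hj, hmin⟩ := exists_lt_of_prefixCard_le h hFD
    obtain ⟨hjF, hjD⟩ := mem_sdiff.1 hj
    have hF' : insert i (F.erase j) ∈ ℋ := hs.insert_erase_mem hij hF (mem_sdiff.1 hi).2 hjF
    have hdiff : D \ insert i (F.erase j) = (D \ F).erase i := by grind
    refine ih #(D \ insert i (F.erase j)) ?_ hF' (fun m hm => ?_) rfl
    · rw [hdiff, ← hN]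
      exact card_erase_lt_of_mem hi
    · exact prefixCard_insert_erase_le hij hi hjF hmin (h m hm)

theorem IsShifted.compl_sdiff_mem_of_prefixCard_le (hs : IsShifted ℋ)
    (hup : IsUpperSet (ℋ : Set (Finset (Fin n)))) (hA : A ∈ ℋ) (hab : prefixCard A b ≤ a) :
    (seg n b \ seg n a)ᶜ ∈ ℋ := by
  refine hs.mem_of_prefixCard_le hup hA fun m hm => ?_
  have hsdiff : seg n m \ (seg n b \ seg n a)ᶜ = seg n (min b m) \ seg n a := by
    grind [mem_compl, mem_seg]
  have hcard := card_seg_sdiff_add_prefixCard (seg n b \ seg n a)ᶜ m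
  rw [hsdiff, card_seg_sdiff_seg] at hcard
  have hb := prefixCard_le_add A b (min b m)
  have h0 := prefixCard_le_add A 0 (min b m)
  have hm' := prefixCard_le_add A (min b m) m
  have : prefixCard A 0 = 0 := by simp [prefixCard, seg]
  lia

/-- The set whose walk goes up `s` times and then repeats one step to the right and two steps up. -/
def skipThird (n s : ℕ) : Finset (Fin n) := {x | x.val < s ∨ ¬ 3 ∣ x.val - s}

theorem prefixCard_skipThird (s : ℕ) (hm : m ≤ n) :
    prefixCard (skipThird n s) m + (m + 2 - s) / 3 = m := by
  induction m with
  | zero => simp [prefixCard, seg]; lia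
  | succ m ih =>
    have hseg : seg n (m + 1) = insert ⟨m, hm⟩ (seg n m) := by grind [mem_seg]
    have hm' : (⟨m, hm⟩ : Fin n) ∈ skipThird n s ↔ m < s ∨ ¬ 3 ∣ m - s := by simp [skipThird]
    specialize ih (by lia)
    rw [prefixCard] at ih ⊢
    by_cases h : (⟨m, hm⟩ : Fin n) ∈ skipThird n s
    · rw [hseg, inter_insert_of_mem h, card_insert_of_notMem (by simp [mem_seg])]
      lia
    · rw [hseg, inter_insert_of_notMem h]
      lia

theorem skipThird_inter_inter_subset :
    skipThird n s ∩ skipThird n (s + 1) ∩ skipThird n (s + 2) ⊆ seg n s := by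
  intro x hx
  simp only [skipThird, mem_inter, mem_filter_univ] at hx
  rw [mem_seg]
  lia

/-- The members of `ℋ` whose walk meets the line `y = 2x + t` for the first time at `(i, t + 2i)`,
that is, after `t + 3i` steps. -/
def hitPart (ℋ : Finset (Finset (Fin n))) (t i : ℕ) : Finset (Finset (Fin n)) :=
  {F ∈ ℋ | t + 2 * i ≤ prefixCard F (t + 3 * i) ∧ ∀ k < i, prefixCard F (t + 3 * k) < t + 2 * k}

theorem exists_le_prefixCard (ht : 1 ≤ t) (hℋ : IsThreeWise t ℋ) (hs : IsShifted ℋ)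
    (hup : IsUpperSet (ℋ : Set (Finset (Fin n)))) (hF : F ∈ ℋ) :
    ∃ i, t + 2 * i ≤ prefixCard F (t + 3 * i) := by
  by_contra! hlow
  have hskip (r : ℕ) : skipThird n (t - 1 + r) ∈ ℋ := by
    refine hs.mem_of_prefixCard_le hup hF fun m hm => ?_
    have hstep := prefixCard_le_add F (t + 3 * ((m - t) / 3)) m
    have h0 := prefixCard_le_add F 0 m
    have : prefixCard F 0 = 0 := by simp [prefixCard, seg]
    have := hlow ((m - t) / 3)
    have := prefixCard_skipThird (t - 1 + r) hm
    lia
  have hcard := (hℋ _ (hskip 0) _ (hskip 1) _ (hskip 2)).trans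
    (card_le_card skipThird_inter_inter_subset)
  rw [card_seg] at hcard
  lia

theorem add_le_of_mem_hitPart (hF : F ∈ hitPart ℋ t i) : t + 3 * i ≤ n := by
  obtain ⟨-, hhit, hfirst⟩ := mem_filter.1 hF
  have hstep := prefixCard_le_add F (t + 3 * (i - 1)) (t + 3 * i)
  have := card_seg_sdiff_add_prefixCard F (t + 3 * i)
  rcases Nat.eq_zero_or_pos i with rfl | hi
  · lia
  · have := hfirst (i - 1) (by lia)
    lia

theorem subset_biUnion_hitPart (ht : 1 ≤ t) (hℋ : IsThreeWise t ℋ) (hs : IsShifted ℋ)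
    (hup : IsUpperSet (ℋ : Set (Finset (Fin n)))) :
    ℋ ⊆ (range (n + 1)).biUnion (hitPart ℋ t) := by
  intro F hF
  have hex := exists_le_prefixCard ht hℋ hs hup hF
  have hhit : F ∈ hitPart ℋ t (Nat.find hex) :=
    mem_filter.2 ⟨hF, Nat.find_spec hex, fun k hk => not_le.1 (Nat.find_min hex hk)⟩
  have := add_le_of_mem_hitPart hhit
  exact mem_biUnion.2 ⟨_, mem_range.2 (by lia), hhit⟩

theorem card_seg_sdiff_of_mem_hitPart (hF : F ∈ hitPart ℋ t i) : #(seg n (t + 3 * i) \ F) = i := by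
  have hn := add_le_of_mem_hitPart hF
  obtain ⟨-, hhit, hfirst⟩ := mem_filter.1 hF
  have hstep := prefixCard_le_add F (t + 3 * (i - 1)) (t + 3 * i)
  have := card_seg_sdiff_add_prefixCard F (t + 3 * i)
  rcases Nat.eq_zero_or_pos i with rfl | hi
  · lia
  · have := hfirst (i - 1) (by lia)
    lia

theorem seg_sdiff_subset_of_mem_hitPart (hF : F ∈ hitPart ℋ t (i + 1)) :
    seg n (t + 3 * (i + 1)) \ F ⊆ seg n (t + 3 * i) := by
  have hn := add_le_of_mem_hitPart hF
  have hcard := card_seg_sdiff_of_mem_hitPart hF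
  have hsub : seg n (t + 3 * i) \ F ⊆ seg n (t + 3 * (i + 1)) \ F :=
    sdiff_subset_sdiff (seg_subset_seg (by lia)) subset_rfl
  have hlow := (mem_filter.1 hF).2.2 i (Nat.lt_succ_self i)
  have := card_seg_sdiff_add_prefixCard F (t + 3 * i)
  rw [← eq_of_subset_of_card_le hsub (by lia)]
  exact sdiff_subset

end Walk

section FirstHit

theorem card_mul_card_le_of_intersecting {α : Type*} [DecidableEq α] {W : Finset α}
    {𝒮 : Finset (Finset α)} {r : ℕ} (hr : 2 * r ≤ #W) (h𝒮 : 𝒮 ⊆ W.powersetCard r)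
    (hinter : (𝒮 : Set (Finset α)).Intersecting) :
    #𝒮 * #W ≤ r * (#W).choose r := by
  let f : Fin #W ↪ α := W.equivFin.symm.toEmbedding.trans (Function.Embedding.subtype (· ∈ W))
  have himage : 𝒮 ⊆ ({B | B.map f ∈ 𝒮} : Finset (Finset (Fin #W))).image (·.map f) := by
    intro S hS
    have hSW : S ⊆ univ.map f := by
      intro x hx
      have hxW := (mem_powersetCard.1 (h𝒮 hS)).1 hx
      exact mem_map.2 ⟨W.equivFin ⟨x, hxW⟩, mem_univ _, by simp [f]⟩
    obtain ⟨B, -, rfl⟩ := subset_map_iff.1 hSW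
    exact mem_image_of_mem _ (by simpa using hS)
  have hcard : #𝒮 ≤ (#W - 1).choose (r - 1) := by
    refine (card_le_card himage).trans (card_image_le.trans (erdos_ko_rado ?_ ?_ (by lia)))
    · intro A hA B hB hAB
      rw [mem_coe, mem_filter_univ] at hA hB
      exact hinter hA hB ((disjoint_map f).2 hAB)
    · intro A hA
      rw [mem_coe, mem_filter_univ] at hA
      simpa using (mem_powersetCard.1 (h𝒮 hA)).2
  rcases Nat.eq_zero_or_pos r with rfl | hr₀
  · suffices 𝒮 = ∅ by simp [this]
    refine eq_empty_of_forall_notMem fun S hS => hinter.ne_bot hS ?_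
    simpa using h𝒮 hS
  · have hchoose := Nat.add_one_mul_choose_eq (#W - 1) (r - 1)
    rw [Nat.sub_add_cancel (by lia), Nat.sub_add_cancel hr₀] at hchoose
    rw [mul_comm r, ← hchoose, mul_comm]
    gcongr

variable {n t i : ℕ} {p v : ℝ} {ℋ : Finset (Finset (Fin n))} {F : Finset (Fin n)}

theorem seg_sdiff_mem_powersetCard_of_mem_hitPart (hi : i ≤ 2) (hF : F ∈ hitPart ℋ t i) :
    seg n (t + 3 * i) \ F ∈ (seg n (t + 2 * i - 1)).powersetCard i := by
  refine mem_powersetCard.2 ⟨?_, card_seg_sdiff_of_mem_hitPart hF⟩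
  cases i with
  | zero =>
    have := card_seg_sdiff_of_mem_hitPart hF
    rw [card_eq_zero.1 this]
    exact empty_subset _
  | succ i => exact (seg_sdiff_subset_of_mem_hitPart hF).trans (seg_subset_seg (by lia))

theorem intersecting_heavy_seg (ht : 1 ≤ t) (hn : t + 3 * i ≤ n) (hp₀ : 0 ≤ p) (hp : p ≤ 1 / 15)
    (hℋ : IsThreeWise t ℋ) (hs : IsShifted ℋ) (hup : IsUpperSet (ℋ : Set (Finset (Fin n))))
    (hfam : ¬ ℋ ⊆ fam n t i) :
    (heavy p ℋ (seg n (t + 3 * i)) ((seg n (t + 2 * i - 1)).powersetCard i) :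
      Set (Finset (Fin n))).Intersecting := by
  intro M hM M' hM' hdisj
  obtain ⟨A, hA, hAfam⟩ := not_subset.1 hfam
  have hD := hs.compl_sdiff_mem_of_prefixCard_le hup hA (b := t + 3 * i) (a := t + 2 * i - 1) (by
    rw [fam, mem_filter_univ, ← prefixCard] at hAfam
    lia)
  have hcard := le_card_of_mem_heavy hp₀ hp hℋ hup hD hM hM'
  obtain ⟨hMsub, hMcard⟩ := mem_powersetCard.1 (mem_filter.1 hM).1
  obtain ⟨hMsub', hMcard'⟩ := mem_powersetCard.1 (mem_filter.1 hM').1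
  have hsub : seg n (t + 2 * i - 1) ⊆ seg n (t + 3 * i) := seg_subset_seg (by lia)
  have hset : (seg n (t + 3 * i) ∩ (seg n (t + 3 * i) \ seg n (t + 2 * i - 1))ᶜ) \ (M ∪ M') =
      seg n (t + 2 * i - 1) \ (M ∪ M') := by grind [mem_compl]
  rw [hset, card_sdiff_of_subset (union_subset hMsub hMsub'), card_union_of_disjoint hdisj,
    card_seg] at hcard
  lia

/-- The product of `p ^ t` with `hitTerm t (p ^ 2 * (1 - p)) i` is the union bound for the measure
of the sets missing exactly `i` of the first `t + 3i` elements. -/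
noncomputable def hitTerm (t : ℕ) (v : ℝ) (i : ℕ) : ℝ := (t + 3 * i).choose i * v ^ i

theorem hitTerm_nonneg (hv : 0 ≤ v) : 0 ≤ hitTerm t v i := by
  rw [hitTerm]
  positivity

theorem mu_hitPart_eq_zero (hn : n < t + 3 * i) : mu p (hitPart ℋ t i) = 0 := by
  have hempty : hitPart ℋ t i = ∅ :=
    eq_empty_of_forall_notMem fun F hF => hn.not_ge (add_le_of_mem_hitPart hF)
  rw [hempty, mu, sum_empty]

theorem mu_hitPart_le (hp₀ : 0 ≤ p) (hp₁ : p ≤ 1) :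
    mu p (hitPart ℋ t i) ≤ p ^ t * hitTerm t (p ^ 2 * (1 - p)) i := by
  have : 0 ≤ 1 - p := sub_nonneg.2 hp₁
  by_cases hn : t + 3 * i ≤ n
  · have hU : #(seg n (t + 3 * i)) = t + 2 * i + i := by
      rw [card_seg]
      lia
    refine (mu_le_mul_card hp₀ hp₁ (fun F hF => mem_powersetCard.2
      ⟨sdiff_subset, card_seg_sdiff_of_mem_hitPart hF⟩) subset_rfl hU).trans_eq ?_
    rw [card_powersetCard, hU, add_assoc, show 2 * i + i = 3 * i by ring, hitTerm, mul_pow,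
      ← pow_mul, pow_add]
    ring
  · have : 0 ≤ hitTerm t (p ^ 2 * (1 - p)) i := hitTerm_nonneg (by positivity)
    rw [mu_hitPart_eq_zero (not_le.1 hn)]
    positivity

theorem mu_hitPart_le_of_not_subset (ht : 241 ≤ t) (hi : i ≤ 2) (hp₀ : 0 ≤ p) (hp : p ≤ 1 / 15)
    (hℋ : IsThreeWise t ℋ) (hs : IsShifted ℋ) (hup : IsUpperSet (ℋ : Set (Finset (Fin n))))
    (hfam : t + 3 * i ≤ n → ¬ ℋ ⊆ fam n t i) :
    mu p (hitPart ℋ t i) ≤ p ^ t * (hitTerm t (p ^ 2 * (1 - p)) i / 12) := by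
  have : 0 ≤ 1 - p := by linarith
  by_cases hn : t + 3 * i ≤ n
  swap
  · have : 0 ≤ hitTerm t (p ^ 2 * (1 - p)) i := hitTerm_nonneg (by positivity)
    rw [mu_hitPart_eq_zero (not_le.1 hn)]
    positivity
  set W := seg n (t + 2 * i - 1)
  set 𝓜 := W.powersetCard i with h𝓜
  have hW : #W = t + 2 * i - 1 := by
    rw [card_seg]
    lia
  have hheavy : #(heavy p ℋ (seg n (t + 3 * i)) 𝓜) * #W ≤ i * (#W).choose i :=
    card_mul_card_le_of_intersecting (by lia) (filter_subset _ _)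
      (intersecting_heavy_seg (by lia) hn hp₀ hp hℋ hs hup (hfam hn))
  have hheavy' : #(heavy p ℋ (seg n (t + 3 * i)) 𝓜) * 120 ≤ (#W).choose i := by
    have : 240 ≤ #W := by lia
    nlinarith
  calc mu p (hitPart ℋ t i)
      ≤ p ^ (t + 2 * i) * (1 - p) ^ i * (#(heavy p ℋ (seg n (t + 3 * i)) 𝓜) + #𝓜 * (3 / 40)) :=
        mu_le_mul_card_heavy_add hp₀ (by linarith)
          (fun F hF => ⟨(mem_filter.1 hF).1, seg_sdiff_mem_powersetCard_of_mem_hitPart hi hF⟩)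
          (powersetCard_mono (seg_subset_seg (by lia))) (by rw [card_seg]; lia)
    _ ≤ p ^ (t + 2 * i) * (1 - p) ^ i * ((t + 3 * i).choose i / 12) := by
        gcongr
        have hchoose : ((#W).choose i : ℝ) ≤ (t + 3 * i).choose i := by
          exact_mod_cast Nat.choose_le_choose i (by lia)
        have : (#(heavy p ℋ (seg n (t + 3 * i)) 𝓜) : ℝ) * 120 ≤ (#W).choose i := by
          exact_mod_cast hheavy'
        rw [h𝓜, card_powersetCard]
        linarith
    _ = p ^ t * (hitTerm t (p ^ 2 * (1 - p)) i / 12) := by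
        rw [hitTerm, mul_pow, ← pow_mul, pow_add]
        ring

theorem add_one_mul_choose_add_three_le {N k : ℕ} (hk : 3 * (k + 1) ≤ N) :
    4 * (k + 1) * (N + 3).choose (k + 1) ≤ 9 * (N + 1) * N.choose k := by
  have h₃ := Nat.add_one_mul_choose_eq (N + 2) k
  have h₂ := Nat.choose_mul_succ_eq (N + 1) k
  have h₁ := Nat.choose_mul_succ_eq N k
  obtain ⟨d, hd⟩ : ∃ d, N + 1 = d + k := ⟨N + 1 - k, by lia⟩
  rw [show N + 1 + 1 - k = d + 1 by lia] at h₂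
  rw [show N + 1 - k = d by lia] at h₁
  have hfactor : 4 * ((N + 3) * (N + 2)) ≤ 9 * ((d + 1) * d) := by
    nlinarith
  refine Nat.le_of_mul_le_mul_right ?_ (show 0 < (d + 1) * d by nlinarith)
  calc 4 * (k + 1) * (N + 3).choose (k + 1) * ((d + 1) * d)
      = 4 * ((N + 3) * (N + 2)) * ((N + 1) * N.choose k) := by
        zify at h₁ h₂ h₃ ⊢
        linear_combination (-4 * (d + 1) * d : ℤ) * h₃ - 4 * (N + 3) * d * h₂
          - 4 * (N + 3) * (N + 2) * h₁
    _ ≤ 9 * ((d + 1) * d) * ((N + 1) * N.choose k) := by gcongr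
    _ = 9 * (N + 1) * N.choose k * ((d + 1) * d) := by ring

theorem two_mul_hitTerm_succ_le (ht : 241 ≤ t) (hi : 4 ≤ i) (hv : 0 ≤ v) (htv : (t + 2) * v ≤ 1) :
    2 * hitTerm t v (i + 1) ≤ hitTerm t v i := by
  have hchoose : 4 * (i + 1) * ((t + 3 * i + 3).choose (i + 1) : ℝ) ≤
      9 * (t + 3 * i + 1) * (t + 3 * i).choose i := by
    exact_mod_cast add_one_mul_choose_add_three_le (N := t + 3 * i) (by lia)
  have hratio : 18 * (t + 3 * i + 1) * v ≤ 4 * (i + 1 : ℝ) := by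
    have hle : 18 * (t + 3 * i + 1) ≤ 4 * (i + 1 : ℝ) * (t + 2) := by
      have : 18 * (t + 3 * i + 1) ≤ 4 * (i + 1) * (t + 2) := by nlinarith
      exact_mod_cast this
    nlinarith
  rw [hitTerm, hitTerm, mul_add_one 3 i, ← add_assoc, pow_succ]
  refine le_of_mul_le_mul_left ?_ (show (0 : ℝ) < 4 * (i + 1) by positivity)
  calc 4 * (i + 1 : ℝ) * (2 * ((t + 3 * i + 3).choose (i + 1) * (v ^ i * v)))
      = 4 * (i + 1) * (t + 3 * i + 3).choose (i + 1) * (2 * v * v ^ i) := by ring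
    _ ≤ 9 * (t + 3 * i + 1) * (t + 3 * i).choose i * (2 * v * v ^ i) := by gcongr
    _ = 18 * (t + 3 * i + 1) * v * ((t + 3 * i).choose i * v ^ i) := by ring
    _ ≤ 4 * (i + 1) * ((t + 3 * i).choose i * v ^ i) := by gcongr

theorem sum_range_le_of_two_mul_succ_le {f : ℕ → ℝ} {m : ℕ} (hf : ∀ i, 0 ≤ f i)
    (hhalf : ∀ i ≥ m, 2 * f (i + 1) ≤ f i) (N : ℕ) :
    ∑ i ∈ range N, f i ≤ ∑ i ∈ range m, f i + 2 * f m := by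
  have htail (k : ℕ) : ∑ i ∈ range (m + k), f i + 2 * f (m + k) ≤ ∑ i ∈ range m, f i + 2 * f m := by
    induction k with
    | zero => rfl
    | succ k ih =>
      rw [← add_assoc, sum_range_succ]
      linarith [hhalf (m + k) (by lia)]
  calc ∑ i ∈ range N, f i ≤ ∑ i ∈ range (m + N), f i :=
        sum_le_sum_of_subset_of_nonneg (range_subset_range.2 (by lia)) fun i _ _ => hf i
    _ ≤ ∑ i ∈ range m, f i + 2 * f m := by linarith [htail N, hf (m + N)]

theorem hitTerm_le (ht : 241 ≤ t) (hv : 0 ≤ v) (htv : (t + 2) * v ≤ 1) :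
    hitTerm t v i ≤ (1 + i / 81) ^ i / i.factorial := by
  have hi : (i : ℝ) * (243 * v) ≤ i * 1 := by
    have : (241 : ℝ) ≤ t := by exact_mod_cast ht
    gcongr
    nlinarith
  calc hitTerm t v i ≤ (t + 3 * i : ℕ) ^ i / i.factorial * v ^ i := by
        rw [hitTerm]
        gcongr
        exact Nat.choose_le_pow_div i (t + 3 * i)
    _ = ((t + 3 * i) * v) ^ i / i.factorial := by
        rw [div_mul_eq_mul_div, ← mul_pow]
        push_cast
        rfl
    _ ≤ (1 + i / 81) ^ i / i.factorial := by
        gcongr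
        linarith

theorem mul_sq_le_of_le_p₀ (hp₀ : 0 < p) (hp : p ≤ p₀ t) : (t + 2) * p ^ 2 ≤ 1 + p := by
  set s := Real.sqrt (4 * t + 9) with hs
  have hsq : s ^ 2 = 4 * t + 9 := Real.sq_sqrt (by positivity)
  have hs₁ : 1 < s := by
    rw [hs, Real.lt_sqrt zero_le_one]
    linarith [t.cast_nonneg (α := ℝ)]
  rw [p₀, le_div_iff₀ (sub_pos.2 hs₁)] at hp
  have hps : (p * s) ^ 2 ≤ (2 + p) ^ 2 := by
    gcongr
    linarith
  rw [mul_pow, hsq] at hps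
  linarith

theorem le_one_div_fifteen_of_mul_sq_le (ht : 241 ≤ t) (hp : (t + 2) * p ^ 2 ≤ 1 + p) :
    p ≤ 1 / 15 := by
  have htp : 243 * p ^ 2 ≤ 1 + p := by
    have : (241 : ℝ) ≤ t := by exact_mod_cast ht
    nlinarith
  nlinarith

theorem mul_sq_mul_one_sub_le_one (hp₁ : p ≤ 1) (hp : (t + 2) * p ^ 2 ≤ 1 + p) :
    (t + 2) * (p ^ 2 * (1 - p)) ≤ 1 := calc
  (t + 2) * (p ^ 2 * (1 - p)) = (t + 2) * p ^ 2 * (1 - p) := (mul_assoc _ _ _).symm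
  _ ≤ (1 + p) * (1 - p) := mul_le_mul_of_nonneg_right hp (sub_nonneg.2 hp₁)
  _ ≤ 1 := by linarith [sq_nonneg p]

theorem sum_hitTerm_lt (ht : 241 ≤ t) (hv : 0 ≤ v) (htv : (t + 2) * v ≤ 1) (N : ℕ) :
    ∑ i ∈ range N, (if i ≤ 2 then hitTerm t v i / 12 else hitTerm t v i) < 1 / 2 := by
  let f (i : ℕ) : ℝ := if i ≤ 2 then hitTerm t v i / 12 else hitTerm t v i
  have hf₀ (i : ℕ) : 0 ≤ f i := by
    have : 0 ≤ hitTerm t v i := hitTerm_nonneg hv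
    dsimp only [f]
    split_ifs <;> positivity
  have hsum : ∑ i ∈ range N, f i ≤ ∑ i ∈ range 4, f i + 2 * f 4 := by
    refine sum_range_le_of_two_mul_succ_le hf₀ (fun i hi => ?_) N
    dsimp only [f]
    rw [if_neg (by lia), if_neg (by lia)]
    exact two_mul_hitTerm_succ_le ht hi hv htv
  have hlt : ∑ i ∈ range 4, f i + 2 * f 4 < 1 / 2 := by
    have hbound (i : ℕ) := hitTerm_le (i := i) ht hv htv
    have h₀ := hbound 0
    have h₁ := hbound 1
    have h₂ := hbound 2
    have h₃ := hbound 3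
    have h₄ := hbound 4
    norm_num [Nat.factorial, sum_range_succ, f] at h₀ h₁ h₂ h₃ h₄ ⊢
    linarith
  exact hsum.trans_lt hlt

theorem mu_lt_of_isShifted (ht : 241 ≤ t) (hp₀ : 0 < p) (hp : (t + 2) * p ^ 2 ≤ 1 + p)
    (hℋ : IsThreeWise t ℋ) (hs : IsShifted ℋ) (hup : IsUpperSet (ℋ : Set (Finset (Fin n))))
    (hfam : ∀ i ≤ 2, t + 3 * i ≤ n → ¬ ℋ ⊆ fam n t i) : mu p ℋ < 1 / 2 * p ^ t := by
  have hp15 := le_one_div_fifteen_of_mul_sq_le ht hp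
  have hp₁ : p ≤ 1 := by linarith
  have : 0 ≤ 1 - p := sub_nonneg.2 hp₁
  set v := p ^ 2 * (1 - p)
  have hv₀ : 0 ≤ v := by positivity
  have htv : (t + 2) * v ≤ 1 := mul_sq_mul_one_sub_le_one hp₁ hp
  let f (i : ℕ) : ℝ := if i ≤ 2 then hitTerm t v i / 12 else hitTerm t v i
  have hf (i : ℕ) : mu p (hitPart ℋ t i) ≤ p ^ t * f i := by
    dsimp only [f]
    split_ifs with hi
    · exact mu_hitPart_le_of_not_subset ht hi hp₀.le hp15 hℋ hs hup (hfam i hi)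
    · exact mu_hitPart_le hp₀.le hp₁
  calc mu p ℋ ≤ mu p ((range (n + 1)).biUnion (hitPart ℋ t)) :=
        mu_mono hp₀.le hp₁ (subset_biUnion_hitPart (by lia) hℋ hs hup)
    _ ≤ ∑ i ∈ range (n + 1), mu p (hitPart ℋ t i) := mu_biUnion_le hp₀.le hp₁ _ _
    _ ≤ ∑ i ∈ range (n + 1), p ^ t * f i := sum_le_sum fun i _ => hf i
    _ = p ^ t * ∑ i ∈ range (n + 1), f i := (mul_sum _ _ _).symm
    _ < p ^ t * (1 / 2) := by
        gcongr
        exact sum_hitTerm_lt ht hv₀ htv _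
    _ = 1 / 2 * p ^ t := mul_comm _ _

end FirstHit

section NearFam

variable {n t i k r : ℕ} {p δ : ℝ} {S A : Finset (Fin n)}

/-- The sets containing all but at most `r` elements of `S`. The families `𝓕_i^t` and their
isomorphic copies are of this form. -/
def nearFam (S : Finset (Fin n)) (r : ℕ) : Finset (Finset (Fin n)) := {A | #(S \ A) ≤ r}

theorem mem_nearFam : A ∈ nearFam S r ↔ #(S \ A) ≤ r := by simp [nearFam]

theorem fam_eq_nearFam (hn : t + 3 * i ≤ n) : fam n t i = nearFam (seg n (t + 3 * i)) i := by
  ext F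
  have := card_seg_sdiff_add_prefixCard F (t + 3 * i)
  rw [fam, mem_filter_univ, ← prefixCard, mem_nearFam]
  lia

theorem mu_nearFam_le (hp₀ : 0 ≤ p) (hp₁ : p ≤ 1) (hS : #S = k + r) :
    mu p (nearFam S r) ≤ (k + r).choose r * p ^ k := by
  have hsub : nearFam S r ⊆ (S.powersetCard r).biUnion fun M => {A | S \ M ⊆ A} := by
    intro A hA
    obtain ⟨M, hAM, hMS, hM⟩ :=
      exists_subsuperset_card_eq (sdiff_subset : S \ A ⊆ S) (mem_nearFam.1 hA) (by lia)
    rw [mem_biUnion]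
    exact ⟨M, mem_powersetCard.2 ⟨hMS, hM⟩, mem_filter_univ _ |>.2 (sdiff_le_comm.1 hAM)⟩
  have hcyl (M) (hM : M ∈ S.powersetCard r) : mu p {A | S \ M ⊆ A} ≤ p ^ k := by
    obtain ⟨hMS, hMr⟩ := mem_powersetCard.1 hM
    have hcard : #(S \ M) = k + 0 := by
      rw [card_sdiff_of_subset hMS]
      lia
    simpa using mu_le_mul_card (𝓜 := {∅}) (m := 0) hp₀ hp₁
      (fun F hF => by simpa using hF) (by simp) hcard
  calc mu p (nearFam S r)
      ≤ ∑ M ∈ S.powersetCard r, mu p {A | S \ M ⊆ A} :=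
        (mu_mono hp₀ hp₁ hsub).trans (mu_biUnion_le hp₀ hp₁ _ _)
    _ ≤ #(S.powersetCard r) • p ^ k := sum_le_card_nsmul _ _ _ hcyl
    _ = (k + r).choose r * p ^ k := by rw [card_powersetCard, hS, nsmul_eq_mul]

theorem add_six_mul_sq_sq_lt (ht : 241 ≤ t) (hp₀ : 0 < p) (hp : (t + 2) * p ^ 2 ≤ 1 + p)
    (hδ : 0 < δ) (hδt : 18 / δ ^ 2 + 12 / δ < t) : ((t + 6) * p ^ 2) ^ 2 < 1 + 2 * δ := by
  have ht' : (241 : ℝ) ≤ t := by exact_mod_cast ht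
  have hp15 := le_one_div_fifteen_of_mul_sq_le ht hp
  have hpδ : p ≤ δ / 3 := by
    have hδt : 18 / δ ^ 2 < t := lt_of_le_of_lt (le_add_of_nonneg_right (by positivity)) hδt
    rw [div_lt_iff₀ (by positivity)] at hδt
    by_contra!
    nlinarith
  set b : ℝ := 4 / (t + 2)
  have hbt : b * (t + 2) = 4 := div_mul_cancel₀ _ (by positivity)
  have hbδ : b ≤ δ / 3 := by
    have hδt : 12 / δ < t := lt_of_le_of_lt (le_add_of_nonneg_left (by positivity)) hδt
    rw [div_lt_iff₀ hδ] at hδt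
    rw [div_le_div_iff₀ (by positivity) (by norm_num)]
    linarith
  have hb15 : b ≤ 1 / 15 := by
    rw [div_le_div_iff₀ (by positivity) (by norm_num)]
    linarith
  have : 0 < b := by positivity
  calc ((t + 6) * p ^ 2) ^ 2 = ((1 + b) * ((t + 2) * p ^ 2)) ^ 2 := by
        congr 1
        linear_combination -p ^ 2 * hbt
    _ ≤ ((1 + b) * (1 + p)) ^ 2 := by gcongr
    _ ≤ (1 + 16 / 15 * (b + p)) ^ 2 := by
        gcongr
        nlinarith
    _ < 1 + 3 * (b + p) := by nlinarith
    _ ≤ 1 + 2 * δ := by linarith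

theorem mu_lt_of_subset_fam_two {𝒢 : Finset (Finset (Fin n))} (ht : 241 ≤ t) (hn : t + 3 * 2 ≤ n)
    (hp₀ : 0 < p) (hp : (t + 2) * p ^ 2 ≤ 1 + p) (h𝒢 : 𝒢 ⊆ fam n t 2) (hδ : 0 < δ)
    (hδt : 18 / δ ^ 2 + 12 / δ < t) : mu p 𝒢 < (1 / 2 + δ) * p ^ t := by
  have hp₁ : p ≤ 1 := by linarith [le_one_div_fifteen_of_mul_sq_le ht hp]
  have hchoose : ((t + 4 + 2).choose 2 : ℝ) ≤ (t + 6) ^ 2 / 2 := by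
    simpa [add_assoc, Nat.factorial] using Nat.choose_le_pow_div (α := ℝ) 2 (t + 4 + 2)
  calc mu p 𝒢 ≤ mu p (nearFam (seg n (t + 3 * 2)) 2) :=
        mu_mono hp₀.le hp₁ (h𝒢.trans_eq (fam_eq_nearFam hn))
    _ ≤ (t + 4 + 2).choose 2 * p ^ (t + 4) :=
        mu_nearFam_le hp₀.le hp₁ (by rw [card_seg]; lia)
    _ ≤ (t + 6) ^ 2 / 2 * p ^ (t + 4) := by gcongr
    _ = ((t + 6) * p ^ 2) ^ 2 / 2 * p ^ t := by ring
    _ < (1 + 2 * δ) / 2 * p ^ t := by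
        gcongr
        exact add_six_mul_sq_sq_lt ht hp₀ hp hδ hδt
    _ = (1 / 2 + δ) * p ^ t := by ring

end NearFam

section Backtracking

variable {n t r : ℕ} {p : ℝ} {𝒢 : Finset (Finset (Fin n))} {S P A B : Finset (Fin n)}
  {i j : Fin n}

theorem mem_shift_or_insert_erase_mem_shift (hA : A ∈ 𝒢) :
    A ∈ shift i j 𝒢 ∨ i ∉ A ∧ j ∈ A ∧ insert i (A.erase j) ∈ shift i j 𝒢 := by
  rw [mem_shift_iff, mem_shift_iff]
  grind [insert_erase_insert_erase]

theorem subset_nearFam_of_shift_subset (h : shift i j 𝒢 ⊆ nearFam S r) (hS : i ∈ S → j ∈ S) :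
    𝒢 ⊆ nearFam S r := by
  intro A hA
  rcases mem_shift_or_insert_erase_mem_shift (i := i) (j := j) hA with hA | ⟨hi, hj, hA⟩
  · exact h hA
  have hcard := mem_nearFam.1 (h hA)
  rw [mem_nearFam]
  by_cases hiS : i ∈ S
  · have hset : S \ insert i (A.erase j) = insert j ((S \ A).erase i) := by grind
    rwa [hset, card_insert_of_notMem (by grind), card_erase_add_one (by grind)] at hcard
  · exact (card_le_card (by grind)).trans hcard

theorem subset_nearFam_erase_of_shift_subset (h : shift i j 𝒢 ⊆ nearFam S r) :
    𝒢 ⊆ nearFam (S.erase i) r := by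
  intro A hA
  rw [mem_nearFam]
  rcases mem_shift_or_insert_erase_mem_shift (i := i) (j := j) hA with hA | ⟨-, -, hA⟩ <;>
  exact (card_le_card (by grind)).trans (mem_nearFam.1 (h hA))

theorem exists_notMem_of_not_subset_nearFam_insert (h : 𝒢 ⊆ nearFam P r)
    (hi : ¬ 𝒢 ⊆ nearFam (insert i P) r) : ∃ A ∈ 𝒢, i ∉ A ∧ r ≤ #(P \ A) := by
  obtain ⟨A, hA, hAS⟩ := not_subset.1 hi
  rw [mem_nearFam, not_le] at hAS
  have hAP := mem_nearFam.1 (h hA)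
  refine ⟨A, hA, fun hiA => ?_, ?_⟩
  · rw [insert_sdiff_of_mem P hiA] at hAS
    lia
  · have := card_le_card (show insert i P \ A ⊆ insert i (P \ A) by grind)
    have := card_insert_le i (P \ A)
    lia

theorem card_erase_sdiff_union_lt (hup : IsUpperSet (𝒢 : Set (Finset (Fin n))))
    (h : shift i j 𝒢 ⊆ nearFam S r) (hi : i ∈ S) (hj : j ∉ S) (hA : A ∈ 𝒢) (hiA : i ∉ A)
    (hB : B ∈ 𝒢) (hjB : j ∉ B) : #(S.erase i \ (A ∪ B)) < r := by
  set R := (A ∪ B) \ {i, j}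
  have hjR : insert j R ∈ 𝒢 := hup (by grind) hA
  have hiR : insert i R ∈ 𝒢 := hup (by grind) hB
  have hmem : insert j R ∈ shift i j 𝒢 := by
    rw [mem_shift_iff]
    have hset : insert i ((insert j R).erase j) = insert i R := by grind
    exact .inl ⟨hjR, fun _ _ => hset ▸ hiR⟩
  have hset : S \ insert j R = insert i (S.erase i \ (A ∪ B)) := by grind
  have hcard := mem_nearFam.1 (h hmem)
  rwa [hset, card_insert_of_notMem (by grind)] at hcard

theorem card_heavy_image_pair_le_one (hp₀ : 0 ≤ p) (hp : p ≤ 1 / 15) (h𝒢 : IsThreeWise t 𝒢)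
    (hup : IsUpperSet (𝒢 : Set (Finset (Fin n)))) (hP : #P = t + 2) (hB : B ∈ 𝒢) (hjB : j ∉ B)
    {b : Fin n} (hbP : b ∈ P) (hbB : b ∉ B) :
    #(heavy p 𝒢 (insert i (insert j P)) ((P.erase b).image ({i, ·}))) ≤ 1 := by
  rw [card_le_one]
  intro M hM M' hM'
  have hcard := le_card_of_mem_heavy hp₀ hp h𝒢 hup hB hM hM'
  obtain ⟨a, ha, rfl⟩ := mem_image.1 (mem_filter.1 hM).1
  obtain ⟨a', ha', rfl⟩ := mem_image.1 (mem_filter.1 hM').1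
  by_contra hne
  have haa' : a ≠ a' := by grind
  have hle := card_le_card (show (insert i (insert j P) ∩ B) \ ({i, a} ∪ {i, a'}) ⊆
    ((P.erase b).erase a).erase a' by grind)
  have := card_erase_add_one (show a' ∈ (P.erase b).erase a by grind)
  have := card_erase_add_one ha
  have := card_erase_add_one hbP
  lia

theorem mu_filter_notMem_not_subset_le (hp₀ : 0 ≤ p) (hp : p ≤ 1 / 15) (h𝒢 : IsThreeWise t 𝒢)
    (hup : IsUpperSet (𝒢 : Set (Finset (Fin n)))) (hij : i ≠ j) (hi : i ∉ P) (hj : j ∉ P)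
    (hP : #P = t + 2) (hnear : 𝒢 ⊆ nearFam P 1)
    (hcross : ∀ A ∈ 𝒢, i ∉ A → ∀ B ∈ 𝒢, j ∉ B → P ⊆ A ∪ B) (hB : B ∈ 𝒢) (hjB : j ∉ B)
    (hPB : ¬ P ⊆ B) :
    mu p {F ∈ 𝒢 | i ∉ F ∧ ¬ P ⊆ F} ≤ p ^ (t + 2) * (1 - p) ^ 2 * (1 + (t + 1) * (3 / 40)) := by
  have : 0 ≤ 1 - p := by linarith
  obtain ⟨b, hbP, hbB⟩ := not_subset.1 hPB
  set U := insert i (insert j P)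
  set 𝓜 := (P.erase b).image ({i, ·} : Fin n → Finset (Fin n))
  have h𝓜 : #𝓜 ≤ t + 1 := card_image_le.trans_eq (by rw [card_erase_of_mem hbP]; lia)
  have htrace (F) (hF : F ∈ ({F ∈ 𝒢 | i ∉ F ∧ ¬ P ⊆ F} : Finset _)) : F ∈ 𝒢 ∧ U \ F ∈ 𝓜 := by
    obtain ⟨hF, hiF, hPF⟩ := mem_filter.1 hF
    have hjF : j ∈ F := by
      by_contra hjF
      exact hPF ((hcross F hF hiF F hF hjF).trans_eq (union_self F))
    obtain ⟨a, ha⟩ := card_eq_one.1 ((mem_nearFam.1 (hnear hF)).antisymm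
      (card_pos.2 (sdiff_nonempty.2 hPF)))
    have haPF : a ∈ P \ F := ha ▸ mem_singleton_self a
    have hPFB := hcross F hF hiF B hB hjB
    have hUF : insert i (insert j P) \ F = insert i (P \ F) := by grind
    exact ⟨hF, mem_image.2 ⟨a, by grind, by rw [hUF, ha]⟩⟩
  refine (mu_le_mul_card_heavy_add hp₀ (by linarith) htrace (m := 2) (k := t + 2) ?_ ?_).trans ?_
  · intro M hM
    obtain ⟨a, ha, rfl⟩ := mem_image.1 hM
    exact mem_powersetCard.2 ⟨by grind, card_pair (by grind)⟩
  · rw [card_insert_of_notMem (by grind), card_insert_of_notMem hj, hP]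
  · gcongr
    · exact_mod_cast card_heavy_image_pair_le_one hp₀ hp h𝒢 hup hP hB hjB hbP hbB
    · exact_mod_cast h𝓜

theorem mu_filter_mem_mem_not_subset_le (hp₀ : 0 ≤ p) (hp₁ : p ≤ 1) (hij : i ≠ j) (hi : i ∉ P)
    (hj : j ∉ P) (hP : #P = t + 2) (hnear : 𝒢 ⊆ nearFam P 1) :
    mu p {F ∈ 𝒢 | i ∈ F ∧ j ∈ F ∧ ¬ P ⊆ F} ≤ p ^ (t + 3) * (1 - p) * (t + 2) := by
  have hcard : #(insert i (insert j P)) = t + 3 + 1 := by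
    rw [card_insert_of_notMem (by grind), card_insert_of_notMem hj, hP]
  refine (mu_le_mul_card hp₀ hp₁ (𝓜 := P.powersetCard 1) (fun F hF => ?_)
    (powersetCard_mono (by grind)) hcard).trans_eq (by simp [hP])
  obtain ⟨hF, hiF, hjF, hPF⟩ := mem_filter.1 hF
  have hset : insert i (insert j P) \ F = P \ F := by grind
  rw [hset, mem_powersetCard]
  exact ⟨sdiff_subset, (mem_nearFam.1 (hnear hF)).antisymm (card_pos.2 (sdiff_nonempty.2 hPF))⟩

theorem two_mul_side_add_lt_half (ht : 241 ≤ t) (hp₀ : 0 < p) (hp : (t + 2) * p ^ 2 ≤ 1 + p) :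
    2 * (p ^ 2 * (1 - p) ^ 2 * (1 + (t + 1) * (3 / 40))) +
      (p ^ 3 * (1 - p) * (t + 2) + p ^ 2) < 1 / 2 := by
  have hp15 := le_one_div_fifteen_of_mul_sq_le ht hp
  have hp₁ : 0 ≤ 1 - p := by linarith
  have htv := mul_sq_mul_one_sub_le_one (sub_nonneg.1 hp₁) hp
  set v := p ^ 2 * (1 - p)
  have hv : v ≤ 1 / 243 := by
    have : (241 : ℝ) ≤ t := by exact_mod_cast ht
    have : 0 ≤ v := by positivity
    nlinarith
  calc 2 * (p ^ 2 * (1 - p) ^ 2 * (1 + (t + 1) * (3 / 40))) + (p ^ 3 * (1 - p) * (t + 2) + p ^ 2)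
      = (1 - p) * (3 / 20 * ((t + 2) * v) + 37 / 20 * v) + (p * ((t + 2) * v) + p ^ 2) := by ring
    _ ≤ 1 * (3 / 20 * 1 + 37 / 20 * (1 / 243)) + (1 / 15 * 1 + (1 / 15) ^ 2) := by
        gcongr
        linarith
    _ < 1 / 2 := by norm_num

theorem mu_lt_of_subset_union (ht : 241 ≤ t) (hp₀ : 0 < p) (hp : (t + 2) * p ^ 2 ≤ 1 + p)
    (h𝒢 : IsThreeWise t 𝒢) (hup : IsUpperSet (𝒢 : Set (Finset (Fin n)))) (hij : i ≠ j) (hi : i ∉ P)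
    (hj : j ∉ P) (hP : #P = t + 2) (hnear : 𝒢 ⊆ nearFam P 1)
    (hcross : ∀ A ∈ 𝒢, i ∉ A → ∀ B ∈ 𝒢, j ∉ B → P ⊆ A ∪ B) (hA : A ∈ 𝒢) (hiA : i ∉ A)
    (hPA : ¬ P ⊆ A) (hB : B ∈ 𝒢) (hjB : j ∉ B) (hPB : ¬ P ⊆ B) : mu p 𝒢 < 1 / 2 * p ^ t := by
  have hp15 := le_one_div_fifteen_of_mul_sq_le ht hp
  have hp₁ : p ≤ 1 := by linarith
  have hside_i := mu_filter_notMem_not_subset_le hp₀.le hp15 h𝒢 hup hij hi hj hP hnear hcross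
    hB hjB hPB
  have hside_j := mu_filter_notMem_not_subset_le hp₀.le hp15 h𝒢 hup hij.symm hj hi hP hnear
    (fun A hA hjA B hB hiB => (hcross B hB hiB A hA hjA).trans_eq (union_comm B A)) hA hiA hPA
  have hboth := mu_filter_mem_mem_not_subset_le hp₀.le hp₁ hij hi hj hP hnear
  have hcyl : mu p (nearFam P 0) ≤ p ^ (t + 2) := by
    simpa using mu_nearFam_le (r := 0) hp₀.le hp₁ hP
  have hcover : 𝒢 ⊆ ({F ∈ 𝒢 | i ∉ F ∧ ¬ P ⊆ F} ∪ {F ∈ 𝒢 | j ∉ F ∧ ¬ P ⊆ F}) ∪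
      ({F ∈ 𝒢 | i ∈ F ∧ j ∈ F ∧ ¬ P ⊆ F} ∪ nearFam P 0) := by
    intro F hF
    simp only [mem_union, mem_filter, mem_nearFam, Nat.le_zero, card_eq_zero,
      sdiff_eq_empty_iff_subset]
    tauto
  calc mu p 𝒢 ≤ (mu p {F ∈ 𝒢 | i ∉ F ∧ ¬ P ⊆ F} + mu p {F ∈ 𝒢 | j ∉ F ∧ ¬ P ⊆ F}) +
        (mu p {F ∈ 𝒢 | i ∈ F ∧ j ∈ F ∧ ¬ P ⊆ F} + mu p (nearFam P 0)) :=
        (mu_mono hp₀.le hp₁ hcover).trans <| (mu_union_le hp₀.le hp₁).trans <|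
          add_le_add (mu_union_le hp₀.le hp₁) (mu_union_le hp₀.le hp₁)
    _ ≤ 2 * (p ^ (t + 2) * (1 - p) ^ 2 * (1 + (t + 1) * (3 / 40))) +
        (p ^ (t + 3) * (1 - p) * (t + 2) + p ^ (t + 2)) := by linarith
    _ = (2 * (p ^ 2 * (1 - p) ^ 2 * (1 + (t + 1) * (3 / 40))) +
        (p ^ 3 * (1 - p) * (t + 2) + p ^ 2)) * p ^ t := by ring
    _ < 1 / 2 * p ^ t := by
        gcongr
        exact two_mul_side_add_lt_half ht hp₀ hp

theorem exists_subset_nearFam_or_mu_lt_of_shift_subset (ht : 241 ≤ t) (hp₀ : 0 < p)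
    (hp : (t + 2) * p ^ 2 ≤ 1 + p) (h𝒢 : IsThreeWise t 𝒢)
    (hup : IsUpperSet (𝒢 : Set (Finset (Fin n)))) (hij : i ≠ j) (hr : r ≤ 1) (hS : #S = t + 3 * r)
    (h : shift i j 𝒢 ⊆ nearFam S r) :
    (∃ S', #S' = t + 3 * r ∧ 𝒢 ⊆ nearFam S' r) ∨ mu p 𝒢 < 1 / 2 * p ^ t := by
  by_cases hSij : i ∈ S → j ∈ S
  · exact .inl ⟨S, hS, subset_nearFam_of_shift_subset h hSij⟩
  obtain ⟨hi, hj⟩ := Classical.not_imp.1 hSij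
  set P := S.erase i
  have hiP : insert i P = S := insert_erase hi
  have hjP : j ∉ P := by grind
  have hnear : 𝒢 ⊆ nearFam P r := subset_nearFam_erase_of_shift_subset h
  refine or_iff_not_imp_left.2 fun hno => ?_
  obtain ⟨A, hA, hiA, hrA⟩ := exists_notMem_of_not_subset_nearFam_insert (i := i) hnear
    fun hsub => hno ⟨S, hS, hiP ▸ hsub⟩
  obtain ⟨B, hB, hjB, hrB⟩ := exists_notMem_of_not_subset_nearFam_insert (i := j) hnear
    fun hsub => hno ⟨insert j P, by
      rw [card_insert_of_notMem hjP, card_erase_add_one hi, hS], hsub⟩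
  have hcross := fun A hA hiA B hB hjB =>
    card_erase_sdiff_union_lt (A := A) (B := B) hup h hi hj hA hiA hB hjB
  obtain rfl : r = 1 := by
    have := hcross A hA hiA B hB hjB
    lia
  refine mu_lt_of_subset_union ht hp₀ hp h𝒢 hup hij (notMem_erase i S) hjP ?_ hnear
    (fun A hA hiA B hB hjB => ?_) hA hiA ?_ hB hjB ?_
  · rw [card_erase_of_mem hi]
    lia
  · simpa using hcross A hA hiA B hB hjB
  · exact sdiff_nonempty.1 (card_pos.1 hrA)
  · exact sdiff_nonempty.1 (card_pos.1 hrB)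

end Backtracking

section ShiftsTo

variable {n t i : ℕ} {p : ℝ} {𝒢 ℋ : Finset (Finset (Fin n))} {S S' : Finset (Fin n)}

/-- `ℋ` results from `𝒢` by finitely many shifts, without being required to be shifted. -/
def ShiftsTo (𝒢 ℋ : Finset (Finset (Fin n))) : Prop :=
  Relation.ReflTransGen (fun 𝒜 ℬ => ∃ i j : Fin n, i < j ∧ ℬ = shift i j 𝒜) 𝒢 ℋ

theorem ShiftsTo.mu_eq (h : ShiftsTo 𝒢 ℋ) : mu p ℋ = mu p 𝒢 := by
  induction h with
  | refl => rfl
  | tail _ hstep ih =>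
    obtain ⟨i, j, -, rfl⟩ := hstep
    rw [mu_shift, ih]

theorem ShiftsTo.isThreeWise (h : ShiftsTo 𝒢 ℋ) (h𝒢 : IsThreeWise t 𝒢) : IsThreeWise t ℋ := by
  induction h with
  | refl => exact h𝒢
  | tail _ hstep ih =>
    obtain ⟨i, j, -, rfl⟩ := hstep
    exact ih.shift

theorem ShiftsTo.isUpperSet (h : ShiftsTo 𝒢 ℋ) (h𝒢 : IsUpperSet (𝒢 : Set (Finset (Fin n)))) :
    IsUpperSet (ℋ : Set (Finset (Fin n))) := by
  induction h with
  | refl => exact h𝒢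
  | tail _ hstep ih =>
    obtain ⟨i, j, -, rfl⟩ := hstep
    exact isUpperSet_shift ih

theorem exists_perm_image_eq {α : Type*} [Finite α] [DecidableEq α] {S S' : Finset α}
    (h : #S = #S') : ∃ τ : Equiv.Perm α, S.image τ = S' := by
  let e : {x // x ∈ S} ≃ {x // x ∈ S'} := Finset.equivOfCardEq h
  refine ⟨e.extendSubtype, eq_of_subset_of_card_le ?_ ?_⟩
  · exact image_subset_iff.2 fun x hx => e.extendSubtype_mem x hx
  · rw [card_image_of_injective _ e.extendSubtype.injective, h]

theorem iso_nearFam (h : #S = #S') (r : ℕ) : Iso (nearFam S r) (nearFam S' r) := by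
  obtain ⟨τ, rfl⟩ := exists_perm_image_eq h
  have hcard (A : Finset (Fin n)) : #(S.image τ \ A.image τ) = #(S \ A) := by
    rw [← image_sdiff _ _ τ.injective, card_image_of_injective _ τ.injective]
  refine ⟨τ, ?_⟩
  ext B
  rw [mem_image]
  constructor
  · intro hB
    have himage : (B.image τ.symm).image τ = B := by simp [image_image]
    refine ⟨B.image τ.symm, ?_, himage⟩
    rwa [mem_nearFam, ← hcard, himage, ← mem_nearFam]
  · rintro ⟨A, hA, rfl⟩
    rwa [mem_nearFam, hcard, ← mem_nearFam]

theorem ShiftsTo.exists_subset_nearFam_or_mu_lt {r : ℕ} (h : ShiftsTo 𝒢 ℋ) (ht : 241 ≤ t)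
    (hp₀ : 0 < p) (hp : (t + 2) * p ^ 2 ≤ 1 + p) (h𝒢 : IsThreeWise t 𝒢)
    (hup : IsUpperSet (𝒢 : Set (Finset (Fin n)))) (hr : r ≤ 1) (hS : #S = t + 3 * r)
    (hℋ : ℋ ⊆ nearFam S r) :
    (∃ S', #S' = t + 3 * r ∧ 𝒢 ⊆ nearFam S' r) ∨ mu p 𝒢 < 1 / 2 * p ^ t := by
  induction h using Relation.ReflTransGen.head_induction_on with
  | refl => exact .inl ⟨S, hS, hℋ⟩
  | head hstep _ ih =>
    obtain ⟨i, j, hij, rfl⟩ := hstep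
    rcases ih h𝒢.shift (isUpperSet_shift hup) with ⟨S', hS', hsub⟩ | hmu
    · exact exists_subset_nearFam_or_mu_lt_of_shift_subset ht hp₀ hp h𝒢 hup hij.ne hr hS' hsub
    · exact .inr (mu_shift (p := p) ▸ hmu)

theorem ShiftsTo.exists_iso_fam_or_mu_lt (h : ShiftsTo 𝒢 ℋ) (ht : 241 ≤ t) (hp₀ : 0 < p)
    (hp : (t + 2) * p ^ 2 ≤ 1 + p) (h𝒢 : IsThreeWise t 𝒢)
    (hup : IsUpperSet (𝒢 : Set (Finset (Fin n)))) (hi : i ≤ 1) (hn : t + 3 * i ≤ n)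
    (hℋ : ℋ ⊆ fam n t i) :
    (∃ 𝓕, Iso 𝓕 (fam n t i) ∧ 𝒢 ⊆ 𝓕) ∨ mu p 𝒢 < 1 / 2 * p ^ t := by
  have hseg : #(seg n (t + 3 * i)) = t + 3 * i := by rw [card_seg, min_eq_left hn]
  rw [fam_eq_nearFam hn] at hℋ ⊢
  refine (h.exists_subset_nearFam_or_mu_lt ht hp₀ hp h𝒢 hup hi hseg hℋ).imp_left ?_
  rintro ⟨S, hS, hsub⟩
  exact ⟨nearFam S i, iso_nearFam (hS.trans hseg.symm) i, hsub⟩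

end ShiftsTo

end ThreeWise

theorem mainTheorem2 :
    ∃ t₀ : ℝ → ℕ, ∀ t : ℕ, 241 ≤ t → ∀ p : ℝ, 0 < p → p ≤ ThreeWise.p₀ t →
      ∀ (n : ℕ) (𝒢 : Finset (Finset (Fin n))), ThreeWise.IsThreeWise t 𝒢 →
        ThreeWise.mu p 𝒢 < 1 / 2 * p ^ t ∨
        (∃ i : ℕ, (i = 0 ∨ i = 1) ∧ t + 3 * i ≤ n ∧
          ∃ 𝓕 : Finset (Finset (Fin n)), ThreeWise.Iso 𝓕 (ThreeWise.fam n t i) ∧ 𝒢 ⊆ 𝓕) ∨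
        ((t + 3 * 2 ≤ n ∧
          ∃ 𝒢' ℋ : Finset (Finset (Fin n)), 𝒢 ⊆ 𝒢' ∧ ThreeWise.IsMaximal t 𝒢' ∧
            ThreeWise.ObtainedByShifting 𝒢' ℋ ∧ ℋ ⊆ ThreeWise.fam n t 2) ∧
          ∀ δ : ℝ, 0 < δ → t₀ δ < t → ThreeWise.mu p 𝒢 < (1 / 2 + δ) * p ^ t) := by
  refine ⟨fun δ => ⌈18 / δ ^ 2 + 12 / δ⌉₊, fun t ht p hp₀ hp n 𝒢 h𝒢 => ?_⟩
  have hpt := ThreeWise.mul_sq_le_of_le_p₀ hp₀ hp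
  have hp₁ : p ≤ 1 := by linarith [ThreeWise.le_one_div_fifteen_of_mul_sq_le ht hpt]
  obtain ⟨𝒢', hsub, hmax⟩ := h𝒢.exists_isMaximal
  obtain ⟨ℋ, hℋ⟩ := ThreeWise.exists_obtainedByShifting 𝒢'
  have hshift : ThreeWise.ShiftsTo 𝒢' ℋ := hℋ.1
  have hmu : ThreeWise.mu p 𝒢 ≤ ThreeWise.mu p 𝒢' := ThreeWise.mu_mono hp₀.le hp₁ hsub
  by_cases hfam : ∃ i ≤ 2, t + 3 * i ≤ n ∧ ℋ ⊆ ThreeWise.fam n t i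
  · obtain ⟨i, hi, hn, hℋi⟩ := hfam
    obtain rfl | hi : i = 2 ∨ i ≤ 1 := by lia
    · refine .inr (.inr ⟨⟨hn, 𝒢', ℋ, hsub, hmax, hℋ, hℋi⟩, fun δ hδ hδt => ?_⟩)
      rw [← hshift.mu_eq] at hmu
      exact hmu.trans_lt
        (ThreeWise.mu_lt_of_subset_fam_two ht hn hp₀ hpt hℋi hδ (Nat.lt_of_ceil_lt hδt))
    · rcases hshift.exists_iso_fam_or_mu_lt ht hp₀ hpt hmax.1 hmax.isUpperSet hi hn hℋi with
        ⟨𝓕, hiso, h𝓕⟩ | hlt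
      · exact .inr (.inl ⟨i, by lia, hn, 𝓕, hiso, hsub.trans h𝓕⟩)
      · exact .inl (hmu.trans_lt hlt)
  · rw [← hshift.mu_eq] at hmu
    exact .inl (hmu.trans_lt (ThreeWise.mu_lt_of_isShifted ht hp₀ hpt (hshift.isThreeWise hmax.1)
      hℋ.2 (hshift.isUpperSet hmax.isUpperSet) fun i hi hn hℋi => hfam ⟨i, hi, hn, hℋi⟩))
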